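/- Let $\Omega\subseteq\mathbb{R}^d$ be convex with $\mathrm{Vol}_d(\Omega)>0$ and let $c\ge 0$. For a finite set $X\subset\Omega$ with at least two points let $h_{X,\Omega}=\sup_{x\in\Omega}\min_{y\in X}\|x-y\|_2$ be its fill distance and $q_X=\frac12\min_{x\ne y\in X}\|x-y\|_2$ its separation radius. Call a sequence $(X_N)_{N\in\mathbb{N}}$ of finite subsets of $\Omega$ quasi-uniform with constant $c$ if $h_{X_N,\Omega}\le c\,q_{X_N}$ for all $N$ with $|X_N|\ge 2$. For a finite nonempty set $v\subset\mathbb{R}^d$ let $B_v=\prod_{i=1}^d[\min_{x\in v}x_i,\max_{x\in v}x_i]$ be its bounding box. A median split of $v$ is a partition of $v$ into two nonempty sets $v_1,v_2$ with $\big||v_1|-|v_2|\big|\le 2$ such that, for some coordinate direction $\ell$ of a longest edge of $B_v$ and some median $m$ of the coordinates $x_\ell$, $x\in v$ (a number with at most $|v|/2$ of these coordinates, counted with multiplicity, strictly below it and at most $|v|/2$ strictly above it), we have $x_\ell\ge m$ for $x\in v_1$ and $x_\ell\le m$ for $x\in v_2$. A median-split tree on $X$ is a finite binary tree with root $X$ in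 which every node (cluster) either is a leaf or has exactly two sons, and these form a median split of it. The level $j_v$ of a cluster $v$ is its distance from the root. Then there is a constant $C>0$, depending only on $\Omega$ and $c$, such that for every sequence $(X_N)_{N\in\mathbb{N}}$ that is quasi-uniform in $\Omega$ with constant $c$, every $N$, every median-split tree on $X_N$ and every cluster $v$ of this tree with $|v|\ge 2$, $$C^{-1}\,\mathrm{diam}(B_v)\le \mathrm{diam}(v)\le C\,\mathrm{diam}(B_v)\qquad\text{and}\qquad C^{-1}\,2^{-j_v/d}\le \mathrm{diam}(B_v)\le C\,2^{-j_v/d}.$$ -/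

import Mathlib

open scoped ENNReal NNReal

namespace Samplet

noncomputable section

/-- The fill distance `sup_{x ∈ Ω} min_{y ∈ X} ‖x - y‖` of `X` in `Ω`, as an extended nonnegative
real, so that it is `∞` when `Ω` is unbounded and `X` is finite. -/
def fillDistance {d : ℕ} (Ω : Set (EuclideanSpace ℝ (Fin d)))
    (X : Finset (EuclideanSpace ℝ (Fin d))) : ℝ≥0∞ :=
  ⨆ x ∈ Ω, Metric.infEDist x (X : Set (EuclideanSpace ℝ (Fin d)))

/-- The separation radius `(1/2) min_{x ≠ y} ‖x - y‖` of `X`. -/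
def separationRadius {d : ℕ} (X : Finset (EuclideanSpace ℝ (Fin d))) : ℝ≥0∞ :=
  Set.einfsep (X : Set (EuclideanSpace ℝ (Fin d))) / 2

/-- A sequence of finite point sets in `Ω` is quasi-uniform with constant `c` if the fill distance
is at most `c` times the separation radius, for all its members. The separation radius is defined
for sets with at least two points only. (In a convex set the reverse bound
`separationRadius ≤ fillDistance` holds for every point set with at least two points.) -/
structure IsQuasiUniform {d : ℕ} (Ω : Set (EuclideanSpace ℝ (Fin d))) (c : ℝ≥0)
    (X : ℕ → Finset (EuclideanSpace ℝ (Fin d))) : Prop where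
  subset : ∀ N, (X N : Set (EuclideanSpace ℝ (Fin d))) ⊆ Ω
  fill_le : ∀ N, 2 ≤ (X N).card → fillDistance Ω (X N) ≤ c * separationRadius (X N)

/-- The least `i`-th coordinate of the points of `v`. -/
def coordMin {d : ℕ} (v : Finset (EuclideanSpace ℝ (Fin d))) (i : Fin d) : ℝ :=
  sInf ((fun x : EuclideanSpace ℝ (Fin d) => x i) '' (v : Set (EuclideanSpace ℝ (Fin d))))

/-- The greatest `i`-th coordinate of the points of `v`. -/
def coordMax {d : ℕ} (v : Finset (EuclideanSpace ℝ (Fin d))) (i : Fin d) : ℝ :=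
  sSup ((fun x : EuclideanSpace ℝ (Fin d) => x i) '' (v : Set (EuclideanSpace ℝ (Fin d))))

/-- The bounding box of a nonempty finite set `v`: the smallest axis-parallel hyperrectangle that
contains `v`. -/
def boundingBox {d : ℕ} (v : Finset (EuclideanSpace ℝ (Fin d))) :
    Set (EuclideanSpace ℝ (Fin d)) :=
  {x | ∀ i, coordMin v i ≤ x i ∧ x i ≤ coordMax v i}

/-- The length of the edge of the bounding box of `v` along dimension `i`. -/
def edgeLength {d : ℕ} (v : Finset (EuclideanSpace ℝ (Fin d))) (i : Fin d) : ℝ :=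
  coordMax v i - coordMin v i

/-- `m` is a median of the `i`-th coordinates of the points of `v`: at most half of the points
lie strictly on either side of it. -/
def IsMedian {d : ℕ} (v : Finset (EuclideanSpace ℝ (Fin d))) (i : Fin d) (m : ℝ) : Prop :=
  2 * {x ∈ v | x i < m}.card ≤ v.card ∧ 2 * {x ∈ v | m < x i}.card ≤ v.card

/-- `v₁` and `v₂` arise from `v` by a median split: `v` is the disjoint union of the nonempty sets
`v₁` and `v₂`, which are separated at a median of the coordinates along a longest edge of the
bounding box. Points whose coordinate equals the median may go to either side, as long as the
numbers of points on the two sides stay nearly equal (a difference of two is what arises when the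
side of the larger coordinates takes tied points as long as it has at most half of all points). -/
def IsMedianSplit {d : ℕ} (v v₁ v₂ : Finset (EuclideanSpace ℝ (Fin d))) : Prop :=
  v₁.Nonempty ∧ v₂.Nonempty ∧ Disjoint v₁ v₂ ∧
  (v₁ : Set (EuclideanSpace ℝ (Fin d))) ∪ v₂ = v ∧
  v₁.card ≤ v₂.card + 2 ∧ v₂.card ≤ v₁.card + 2 ∧
  ∃ (l : Fin d) (m : ℝ), (∀ i, edgeLength v i ≤ edgeLength v l) ∧ IsMedian v l m ∧
    (∀ x ∈ v₁, m ≤ x l) ∧ (∀ x ∈ v₂, x l ≤ m)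

/-- Finite binary trees in which every node carries a cluster and has no sons or two sons. -/
inductive ClusterTree (α : Type) : Type where
  | leaf (v : Finset α) : ClusterTree α
  | node (v : Finset α) (son₁ son₂ : ClusterTree α) : ClusterTree α

/-- The cluster at the root. -/
def ClusterTree.root {α : Type} : ClusterTree α → Finset α
  | .leaf v => v
  | .node v _ _ => v

/-- `T.HasCluster j w`: some node of `T` on level `j` carries the cluster `w`; the level is the
number of son relations between the root and the node. -/
def ClusterTree.HasCluster {α : Type} : ClusterTree α → ℕ → Finset α → Prop
  | .leaf v, 0, w => w = v
  | .leaf _, _ + 1, _ => False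
  | .node v _ _, 0, w => w = v
  | .node _ s t, j + 1, w => s.HasCluster j w ∨ t.HasCluster j w

/-- Every cluster with sons is split into its two sons by a median split. No stopping rule is
prescribed: subdivision down to any threshold for the cluster size, or to any common depth, is
included. -/
def ClusterTree.IsMedianSplitTree {d : ℕ} : ClusterTree (EuclideanSpace ℝ (Fin d)) → Prop
  | .leaf _ => True
  | .node v s t => IsMedianSplit v s.root t.root ∧ s.IsMedianSplitTree ∧ t.IsMedianSplitTree

/-- `a` and `b` are equivalent up to the constant `C`. -/
def Comparable (C a b : ℝ) : Prop := a ≤ C * b ∧ b ≤ C * a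

end

end Samplet

namespace Samplet

open MeasureTheory Metric

variable {d : ℕ}

local notation "𝔼" => EuclideanSpace ℝ (Fin d)

/-! Counting fixes the scale. Splits are balanced up to two points, so a cluster `v` on level `j`
with at least two points has about `2 ^ (-j) * |X|` points, and `|X| * q ^ d` is bounded above and
below because `X` is `q`-separated and `c * q`-dense in a bounded body with interior. Packing bounds
`|v| * q ^ d` by a multiple of `diam (boundingBox v) ^ d`, which is the lower bound for the box. The
upper bound needs the converse: `v` must fill its box up to constants, so boxes must not degenerate.

To `v` belongs a cell `K`, the closure of `Ω` cut by the hyperplanes of the splits above `v`. A cut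
does not make the cell thin in its own direction: a thin slab has a small share of the volume of a
convex body (`volume_slab_le`) and cannot hold nearly half of the points
(`coordWidth_le_of_card_le`).

A cut can, however, narrow `K` in the other directions too, so widths cannot be tracked one by one.
`Anchored` instead remembers, for each set `S` of directions, an earlier body `K'` that was nearly
widest along some `i ∈ S` and has since been cut only outside `S`. If `K` is wide in all directions
outside `S`, a contraction of `K'` into `K` shows that `K` is wide along `i` as well
(`Anchored.exists_mem_le`). Adding wide directions one at a time bounds the aspect ratio
(`Anchored.aspect`). Then `K` contains a ball of radius comparable to its width, and volume counts
its points. `IsCell.half` carries the invariant through a split; cells of width `O(q)` are exempt,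
since there one point suffices for the upper bound. -/

/-! ### Coordinate widths of compact sets -/

/-- The length of the projection of a compact set to the `k`-th coordinate axis. -/
noncomputable def coordWidth (K : Set (EuclideanSpace ℝ (Fin d))) (k : Fin d) : ℝ :=
  sSup ((fun x : EuclideanSpace ℝ (Fin d) => x k) '' K) -
    sInf ((fun x : EuclideanSpace ℝ (Fin d) => x k) '' K)

lemma continuous_coord (k : Fin d) : Continuous (fun x : 𝔼 => x k) := by fun_prop

lemma exists_coordWidth_eq {K : Set 𝔼} (hK : IsCompact K) (hne : K.Nonempty) (k : Fin d) :
    ∃ a ∈ K, ∃ b ∈ K, (∀ x ∈ K, a k ≤ x k ∧ x k ≤ b k) ∧ coordWidth K k = b k - a k := by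
  have him : IsCompact ((fun x : 𝔼 => x k) '' K) := hK.image (continuous_coord k)
  have hine : ((fun x : 𝔼 => x k) '' K).Nonempty := hne.image _
  obtain ⟨a, ha, hak⟩ := him.sInf_mem hine
  obtain ⟨b, hb, hbk⟩ := him.sSup_mem hine
  refine ⟨a, ha, b, hb, fun x hx => ⟨?_, ?_⟩, ?_⟩
  · simp only at hak
    rw [hak]
    exact csInf_le him.bddBelow ⟨x, hx, rfl⟩
  · simp only at hbk
    rw [hbk]
    exact le_csSup him.bddAbove ⟨x, hx, rfl⟩
  · simp only at hak hbk
    rw [coordWidth, hak, hbk]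

lemma sub_le_coordWidth {K : Set 𝔼} (hK : IsCompact K) (k : Fin d) {x y : 𝔼} (hx : x ∈ K)
    (hy : y ∈ K) : x k - y k ≤ coordWidth K k := by
  obtain ⟨a, -, b, -, h, hw⟩ := exists_coordWidth_eq hK ⟨x, hx⟩ k
  linarith [(h x hx).2, (h y hy).1]

lemma abs_sub_le_coordWidth {K : Set 𝔼} (hK : IsCompact K) (k : Fin d) {x y : 𝔼} (hx : x ∈ K)
    (hy : y ∈ K) : |x k - y k| ≤ coordWidth K k :=
  abs_le.2 ⟨by linarith [sub_le_coordWidth hK k hy hx], sub_le_coordWidth hK k hx hy⟩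

lemma coordWidth_nonneg {K : Set 𝔼} (hK : IsCompact K) (hne : K.Nonempty) (k : Fin d) :
    0 ≤ coordWidth K k := by
  obtain ⟨x, hx⟩ := hne
  simpa using sub_le_coordWidth hK k hx hx

lemma coordWidth_mono {K K' : Set 𝔼} (hK : IsCompact K) (hne : K.Nonempty) (hK' : IsCompact K')
    (h : K ⊆ K') (k : Fin d) : coordWidth K k ≤ coordWidth K' k := by
  obtain ⟨a, ha, b, hb, -, hw⟩ := exists_coordWidth_eq hK hne k
  rw [hw]
  exact sub_le_coordWidth hK' k (h hb) (h ha)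

lemma abs_coord_sub_le_dist (x y : 𝔼) (k : Fin d) : |x k - y k| ≤ dist x y := by
  have := PiLp.norm_apply_le (x - y) k
  rwa [PiLp.sub_apply, Real.norm_eq_abs, ← dist_eq_norm] at this

lemma dist_le_of_abs_coord_sub_le {x y : 𝔼} {M : ℝ} (hM : 0 ≤ M) (h : ∀ k, |x k - y k| ≤ M) :
    dist x y ≤ d * M := by
  rw [EuclideanSpace.dist_eq, Real.sqrt_le_left (by positivity)]
  calc ∑ i, dist (x i) (y i) ^ 2 ≤ ∑ _i : Fin d, M ^ 2 := by
        refine Finset.sum_le_sum fun i _ => ?_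
        rw [Real.dist_eq]
        exact pow_le_pow_left₀ (abs_nonneg _) (h i) 2
    _ = d * M ^ 2 := by simp
    _ ≤ (d * M) ^ 2 := by
        rw [mul_pow]
        gcongr
        rcases Nat.eq_zero_or_pos d with rfl | hd
        · simp
        · exact le_self_pow₀ (by exact_mod_cast hd) two_ne_zero

/-! ### Anchored sections and their aspect ratio -/

/-- The `k`-th coordinate of `x` lies in the range of the `k`-th coordinate on `K`. -/
def Bracketed (K : Set (EuclideanSpace ℝ (Fin d))) (k : Fin d)
    (x : EuclideanSpace ℝ (Fin d)) : Prop :=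
  ∃ y ∈ K, ∃ z ∈ K, y k ≤ x k ∧ x k ≤ z k

lemma Bracketed.mono {K K' : Set 𝔼} (h : K ⊆ K') {k : Fin d} {x : 𝔼} (hx : Bracketed K k x) :
    Bracketed K' k x := by
  obtain ⟨y, hy, z, hz, h1, h2⟩ := hx
  exact ⟨y, h hy, z, h hz, h1, h2⟩

/-- `K` is cut out of `K'` by bounds for the coordinates outside `S`. -/
def IsSection (S : Finset (Fin d)) (K' K : Set (EuclideanSpace ℝ (Fin d))) : Prop :=
  K ⊆ K' ∧ ∀ x ∈ K', (∀ k ∉ S, Bracketed K k x) → x ∈ K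

/-- Every set `S` of coordinates contains one, along which `K` was nearly widest before it was last
cut along a coordinate in `S`. -/
def Anchored (c₀ : ℝ) (K : Set (EuclideanSpace ℝ (Fin d))) : Prop :=
  ∀ S : Finset (Fin d), S.Nonempty → ∃ i ∈ S, ∃ K' : Set (EuclideanSpace ℝ (Fin d)),
    Convex ℝ K' ∧ IsCompact K' ∧ IsSection S K' K ∧ ∀ k, c₀ * coordWidth K' k ≤ coordWidth K' i

/-- A convex compact set contains a point that lies deep inside its bounding box. -/
lemma exists_deep_point {K : Set 𝔼} (hd : 0 < d) (hK : IsCompact K) (hc : Convex ℝ K)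
    (hne : K.Nonempty) :
    ∃ p ∈ K, ∀ k (x : 𝔼), |x k - p k| ≤ coordWidth K k / (2 * d) → Bracketed K k x := by
  choose a ha b hb hab hw using exists_coordWidth_eq hK hne
  have hd' : (0 : ℝ) < d := by exact_mod_cast hd
  -- The deep point is the average of the midpoints `m j` of widest chords. In coordinate `k` the
  -- summand `m k` is half a width away from both ends and the others stay in range, so the average
  -- keeps the distance `coordWidth K k / (2 * d)`.
  let m : Fin d → 𝔼 := fun j => (1 / 2 : ℝ) • a j + (1 / 2 : ℝ) • b j
  have hm : ∀ j, m j ∈ K := fun j =>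
    hc (ha j) (hb j) (by norm_num) (by norm_num) (by norm_num)
  refine ⟨∑ j, (1 / (d : ℝ)) • m j, ?_, ?_⟩
  · refine hc.sum_mem (fun i _ => by positivity) ?_ (fun i _ => hm i)
    simp [hd'.ne']
  · intro k x hx
    have hcoord : (∑ j, (1 / (d : ℝ)) • m j) k = (1 / (d : ℝ)) * ∑ j, m j k := by
      simp [Finset.mul_sum]
    have hmk : m k k = (a k k + b k k) / 2 := by
      simp only [m, PiLp.add_apply, PiLp.smul_apply, smul_eq_mul]; ring
    have hlow : a k k * (d : ℝ) + coordWidth K k / 2 ≤ ∑ j, m j k := by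
      have h1 : ∑ j, (m j k - a k k) = ∑ j, m j k - a k k * d := by
        simp [mul_comm]
      have h2 : m k k - a k k ≤ ∑ j, (m j k - a k k) :=
        Finset.single_le_sum (f := fun j => m j k - a k k)
          (fun j _ => sub_nonneg.2 (hab k _ (hm j)).1) (Finset.mem_univ k)
      rw [hw k]; linarith
    have hup : ∑ j, m j k ≤ b k k * (d : ℝ) - coordWidth K k / 2 := by
      have h1 : ∑ j, (b k k - m j k) = b k k * d - ∑ j, m j k := by
        simp [mul_comm]
      have h2 : b k k - m k k ≤ ∑ j, (b k k - m j k) :=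
        Finset.single_le_sum (f := fun j => b k k - m j k)
          (fun j _ => sub_nonneg.2 (hab k _ (hm j)).2) (Finset.mem_univ k)
      rw [hw k]; linarith
    rw [hcoord, abs_le] at hx
    refine ⟨a k, ha k, b k, hb k, ?_, ?_⟩
    · have : a k k + coordWidth K k / (2 * d) ≤ 1 / (d : ℝ) * ∑ j, m j k := by
        have := mul_le_mul_of_nonneg_left hlow (by positivity : (0 : ℝ) ≤ 1 / d)
        refine le_trans (le_of_eq ?_) this
        field_simp
      linarith [hx.1]
    · have : 1 / (d : ℝ) * ∑ j, m j k ≤ b k k - coordWidth K k / (2 * d) := by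
        have := mul_le_mul_of_nonneg_left hup (by positivity : (0 : ℝ) ≤ 1 / d)
        refine le_trans this (le_of_eq ?_)
        field_simp
      linarith [hx.2]

/-- If the coordinates outside `S` have widths at least `M`, then some coordinate in `S` has a
width comparable to `M`. -/
lemma Anchored.exists_mem_le {c₀ : ℝ} {K : Set 𝔼} (hA : Anchored c₀ K) (hd : 0 < d)
    (hK : IsCompact K) (hc : Convex ℝ K) (hne : K.Nonempty) {S : Finset (Fin d)}
    (hS : S.Nonempty) {M : ℝ} (hM : 0 < M) (hout : ∀ k ∉ S, M ≤ coordWidth K k)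
    {l : Fin d} (hl : M ≤ coordWidth K l) :
    ∃ i ∈ S, c₀ / (2 * d) * M ≤ coordWidth K i := by
  obtain ⟨i, hi, K', hc', hK', ⟨hsub, hsec⟩, hmax⟩ := hA S hS
  refine ⟨i, hi, ?_⟩
  have hd' : (1 : ℝ) ≤ d := by exact_mod_cast hd
  have hne' : K'.Nonempty := hne.mono hsub
  obtain ⟨p, hp, hdeep⟩ := exists_deep_point hd hK hc hne
  have : Nonempty (Fin d) := ⟨l⟩
  obtain ⟨L, hL⟩ := Finite.exists_max (coordWidth K')
  obtain ⟨a, ha, b, hb, -, hw⟩ := exists_coordWidth_eq hK' hne' i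
  have hML : M ≤ coordWidth K' L :=
    hl.trans ((coordWidth_mono hK hne hK' hsub l).trans (hL l))
  have hL0 : 0 < coordWidth K' L := hM.trans_le hML
  -- Contracting `K'` towards `p` by the factor `t` moves `p` by at most `M / (2 * d)` in each
  -- coordinate. This is within the depth of `p` in the coordinates outside `S`, and only those are
  -- constrained, so the contracted copy lies in `K`.
  set t : ℝ := M / (2 * d * coordWidth K' L) with ht
  have ht0 : 0 ≤ t := by positivity
  have htL : t * coordWidth K' L = M / (2 * d) := by
    rw [ht]; field_simp
  have ht1 : t ≤ 1 := by
    rw [ht, div_le_one (by positivity)]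
    nlinarith
  have key : ∀ w ∈ K', (1 - t) • p + t • w ∈ K := by
    intro w hw
    refine hsec _ (hc' (hsub hp) hw (by linarith) ht0 (by ring)) fun k hk => hdeep k _ ?_
    have : ((1 - t) • p + t • w) k - p k = t * (w k - p k) := by
      simp only [PiLp.add_apply, PiLp.smul_apply, smul_eq_mul]; ring
    rw [this, abs_mul, abs_of_nonneg ht0]
    calc t * |w k - p k| ≤ t * coordWidth K' L := by
          gcongr
          exact (abs_sub_le_coordWidth hK' k hw (hsub hp)).trans (hL k)
      _ = M / (2 * d) := htL
      _ ≤ coordWidth K k / (2 * d) := by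
          gcongr
          exact hout k hk
  have h := sub_le_coordWidth hK i (key b hb) (key a ha)
  have h' : ((1 - t) • p + t • b) i - ((1 - t) • p + t • a) i = t * coordWidth K' i := by
    rw [hw]
    simp only [PiLp.add_apply, PiLp.smul_apply, smul_eq_mul]; ring
  rw [h'] at h
  calc c₀ / (2 * d) * M = c₀ * (t * coordWidth K' L) := by rw [htL]; ring
    _ = t * (c₀ * coordWidth K' L) := by ring
    _ ≤ t * coordWidth K' i := by gcongr; exact hmax L
    _ ≤ _ := h

/-- The bounding box of an anchored set has bounded aspect ratio. -/
lemma Anchored.aspect {c₀ : ℝ} {K : Set 𝔼} (hA : Anchored c₀ K) (hd : 0 < d)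
    (hK : IsCompact K) (hc : Convex ℝ K) (hne : K.Nonempty) (hc₀ : 0 < c₀) (hc₁ : c₀ ≤ 1)
    (i l : Fin d) : (c₀ / (2 * d)) ^ d * coordWidth K l ≤ coordWidth K i := by
  have hd' : (1 : ℝ) ≤ d := by exact_mod_cast hd
  rcases (coordWidth_nonneg hK hne l).eq_or_lt with h0 | hpos
  · rw [← h0, mul_zero]
    exact coordWidth_nonneg hK hne i
  set g : ℝ := c₀ / (2 * d) with hg
  have hg0 : 0 < g := by positivity
  have hg1 : g ≤ 1 := by
    rw [hg, div_le_one (by positivity)]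
    linarith
  classical
  -- Each further factor `g` admits a new direction, found by applying the anchor to the set of
  -- directions that are still narrow. After `d` rounds none is left.
  have step : ∀ n : ℕ, n < (Finset.univ.filter fun k => g ^ n * coordWidth K l ≤ coordWidth K k).card ∨
      ∀ k, g ^ n * coordWidth K l ≤ coordWidth K k := by
    intro n
    induction n with
    | zero =>
      left
      exact Finset.card_pos.2 ⟨l, by simp⟩
    | succ n ih =>
      have hmono : g ^ (n + 1) * coordWidth K l ≤ g ^ n * coordWidth K l := by
        gcongr ?_ * _
        exact pow_le_pow_of_le_one hg0.le hg1 n.le_succ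
      rcases ih with ih | ih
      · by_cases hall : ∀ k, g ^ n * coordWidth K l ≤ coordWidth K k
        · exact Or.inr fun k => hmono.trans (hall k)
        left
        push Not at hall
        obtain ⟨k₀, hk₀⟩ := hall
        obtain ⟨j, hj, hjw⟩ := hA.exists_mem_le hd hK hc hne
          (S := Finset.univ.filter fun k => coordWidth K k < g ^ n * coordWidth K l)
          ⟨k₀, by simpa using hk₀⟩ (M := g ^ n * coordWidth K l) (by positivity)
          (fun k hk => by simpa using hk) (l := l)
          (mul_le_of_le_one_left hpos.le (pow_le_one₀ hg0.le hg1))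
        refine (Nat.succ_le_of_lt ih).trans_lt (Finset.card_lt_card ?_)
        refine Finset.ssubset_iff_of_subset ?_ |>.2 ⟨j, ?_, ?_⟩
        · intro k hk
          simp only [Finset.mem_filter, Finset.mem_univ, true_and] at hk ⊢
          exact hmono.trans hk
        · simp only [Finset.mem_filter, Finset.mem_univ, true_and]
          refine le_trans (le_of_eq ?_) hjw
          rw [← hg]; ring
        · simpa using hj
      · exact Or.inr fun k => hmono.trans (ih k)
  rcases step d with h | h
  · have := Finset.card_le_univ (Finset.univ.filter fun k => g ^ d * coordWidth K l ≤ coordWidth K k)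
    simp only [Fintype.card_fin] at this
    omega
  · exact h i

/-- A box section of a convex body contains a ball of radius comparable to its smallest width. -/
lemma exists_closedBall_subset {Ω K : Set 𝔼} (hd : 0 < d) (hΩ : Convex ℝ Ω) {x₀ : 𝔼} {r₀ D : ℝ}
    (hball : closedBall x₀ r₀ ⊆ Ω) (hΩD : Ω ⊆ closedBall x₀ D)
    (hK : IsCompact K) (hc : Convex ℝ K) (hne : K.Nonempty) (hsec : IsSection ∅ Ω K) {m : ℝ}
    (hm : 0 < m) (hmw : ∀ k, m ≤ coordWidth K k) :
    ∃ y, closedBall y (r₀ / (4 * d * D) * m) ⊆ K := by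
  obtain ⟨p, hp, hdeep⟩ := exists_deep_point hd hK hc hne
  have hd' : (1 : ℝ) ≤ d := by exact_mod_cast hd
  have hdiff : ∀ x ∈ Ω, ∀ z ∈ Ω, ∀ k, |x k - z k| ≤ 2 * D := fun x hx z hz k =>
    (abs_coord_sub_le_dist x z k).trans
      ((dist_triangle_right x z x₀).trans (by
        have := mem_closedBall.1 (hΩD hx); have := mem_closedBall.1 (hΩD hz); linarith))
  have hm2 : m ≤ 2 * D := by
    obtain ⟨a, ha, b, hb, -, hw⟩ := exists_coordWidth_eq hK hne ⟨0, hd⟩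
    have h1 := hmw ⟨0, hd⟩
    have := hdiff b (hsec.1 hb) a (hsec.1 ha) ⟨0, hd⟩
    rw [hw] at h1
    exact h1.trans ((le_abs_self _).trans this)
  have hD : 0 < D := by linarith
  -- Contracting `Ω` towards `p` by this factor moves coordinates by at most `m / (2 * d)`, the
  -- depth of `p`; the image of the ball in `Ω` is the ball sought.
  set t : ℝ := m / (4 * d * D) with ht
  have ht0 : 0 < t := by positivity
  have ht1 : t ≤ 1 := by
    rw [ht, div_le_one (by positivity)]
    nlinarith
  have htD : t * (2 * D) = m / (2 * d) := by
    rw [ht]; field_simp; norm_num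
  refine ⟨(1 - t) • p + t • x₀, fun z hz => ?_⟩
  obtain ⟨w, hw, rfl⟩ : ∃ w ∈ closedBall x₀ r₀, (1 - t) • p + t • w = z := by
    refine ⟨x₀ + t⁻¹ • (z - ((1 - t) • p + t • x₀)), ?_, ?_⟩
    · rw [mem_closedBall, dist_eq_norm] at hz ⊢
      rw [add_sub_cancel_left, norm_smul, norm_inv, Real.norm_eq_abs, abs_of_pos ht0,
        inv_mul_le_iff₀ ht0]
      refine hz.trans (le_of_eq ?_)
      rw [ht]; ring
    · rw [smul_add, smul_inv_smul₀ ht0.ne']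
      abel
  refine hsec.2 _ (hΩ (hsec.1 hp) (hball hw) (by linarith) ht0.le (by ring)) fun k _ =>
    hdeep k _ ?_
  have : ((1 - t) • p + t • w) k - p k = t * (w k - p k) := by
    simp only [PiLp.add_apply, PiLp.smul_apply, smul_eq_mul]; ring
  rw [this, abs_mul, abs_of_pos ht0]
  calc t * |w k - p k| ≤ t * (2 * D) := by
        gcongr
        exact hdiff w (hball hw) p (hsec.1 hp) k
    _ = m / (2 * d) := htD
    _ ≤ coordWidth K k / (2 * d) := by
        gcongr
        exact hmw k

/-! ### Volumes, packing and covering -/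

lemma volume_real_ball_pos : 0 < volume.real (ball (0 : 𝔼) 1) :=
  ENNReal.toReal_pos (measure_ball_pos _ _ one_pos).ne' measure_ball_lt_top.ne

lemma volume_real_closedBall (x : 𝔼) {r : ℝ} (hr : 0 ≤ r) :
    volume.real (closedBall x r) = r ^ d * volume.real (ball (0 : 𝔼) 1) := by
  simpa using Measure.addHaar_real_closedBall volume x hr

lemma volume_real_ball (x : 𝔼) {r : ℝ} (hr : 0 < r) :
    volume.real (ball x r) = r ^ d * volume.real (ball (0 : 𝔼) 1) := by
  rw [Measure.real, Measure.addHaar_ball_of_pos volume x hr, ENNReal.toReal_mul,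
    ENNReal.toReal_ofReal (by positivity), finrank_euclideanSpace_fin, Measure.real]

lemma volume_real_image_homothety (y : 𝔼) {r : ℝ} (hr : 0 ≤ r) (s : Set 𝔼) :
    volume.real (AffineMap.homothety y r '' s) = r ^ d * volume.real s := by
  rw [Measure.real, Measure.addHaar_image_homothety, ENNReal.toReal_mul,
    ENNReal.toReal_ofReal (abs_nonneg _), finrank_euclideanSpace_fin,
    abs_of_nonneg (by positivity), Measure.real]

lemma homothety_coord (y x : 𝔼) (r : ℝ) (k : Fin d) :
    AffineMap.homothety y r x k = r * (x k - y k) + y k := by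
  simp [AffineMap.homothety_apply]

/-- Balls around separated points inside a set of finite volume. -/
lemma card_mul_le_volume {V : Finset 𝔼} {q : ℝ} (hq : 0 < q)
    (hsep : ∀ x ∈ V, ∀ y ∈ V, x ≠ y → 2 * q ≤ dist x y) {U : Set 𝔼} (hU : volume U ≠ ⊤)
    (hVU : ∀ x ∈ V, ball x q ⊆ U) :
    V.card * (q ^ d * volume.real (ball (0 : 𝔼) 1)) ≤ volume.real U := by
  have h := measureReal_biUnion_finset (μ := volume) (s := V) (f := fun x : 𝔼 => ball x q)
    (fun x hx y hy hxy => ball_disjoint_ball (by linarith [hsep x hx y hy hxy]))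
    (fun x _ => measurableSet_ball) (fun x _ => measure_ball_lt_top.ne)
  simp only [volume_real_ball _ hq, Finset.sum_const, nsmul_eq_mul] at h
  rw [← h]
  exact measureReal_mono (Set.iUnion₂_subset hVU) hU

lemma volume_le_card_mul {V : Finset 𝔼} {h : ℝ} (hh : 0 ≤ h) {A : Set 𝔼}
    (hA : ∀ z ∈ A, ∃ x ∈ V, dist z x ≤ h) :
    volume.real A ≤ V.card * (h ^ d * volume.real (ball (0 : 𝔼) 1)) := by
  have hsub : A ⊆ ⋃ x ∈ V, closedBall x h := fun z hz => by
    obtain ⟨x, hx, hzx⟩ := hA z hz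
    exact Set.mem_iUnion₂.2 ⟨x, hx, hzx⟩
  have hfin : volume (⋃ x ∈ V, closedBall x h) ≠ ⊤ :=
    ((measure_biUnion_lt_top V.finite_toSet fun x _ => measure_closedBall_lt_top)).ne
  refine (measureReal_mono hsub hfin).trans ((measureReal_biUnion_finset_le V _).trans ?_)
  simp [volume_real_closedBall _ hh]

/-! ### Thin slabs of convex bodies -/

/-- Homotheties centred at `b` with ratios between `1 / 2` and `1` map `S` to disjoint sets inside
`K`, each with at least `2 ^ (-d)` of its volume. More than `W / (16 * δ)` of them fit. -/
lemma volume_slab_le_of_far {K S : Set 𝔼} (hK : IsCompact K) (hc : Convex ℝ K) (hSK : S ⊆ K)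
    (hS : MeasurableSet S) (l : Fin d) {b : 𝔼} (hb : b ∈ K) {A W δ : ℝ} (hδ : 0 < δ) (hW : 0 < W)
    (hWA : W ≤ 4 * A) (hA : ∀ x ∈ S, A ≤ |x l - b l| ∧ |x l - b l| ≤ A + δ) :
    W * volume.real S ≤ 16 * 2 ^ d * δ * volume.real K := by
  set J : ℕ := ⌊W / (16 * δ)⌋₊ with hJ
  have hJle : (J : ℝ) ≤ W / (16 * δ) := Nat.floor_le (by positivity)
  have hJlt : W / (16 * δ) < J + 1 := Nat.lt_floor_add_one _
  set r : ℕ → ℝ := fun j => 1 - j * (8 * δ / W) with hr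
  have hr_half : ∀ j ∈ Finset.range (J + 1), 1 / 2 ≤ r j := by
    intro j hj
    have hjJ : (j : ℝ) ≤ J := by exact_mod_cast Nat.lt_succ_iff.1 (Finset.mem_range.1 hj)
    have : (j : ℝ) * (8 * δ / W) ≤ W / (16 * δ) * (8 * δ / W) := by
      gcongr; exact hjJ.trans hJle
    have h2 : W / (16 * δ) * (8 * δ / W) = 1 / 2 := by field_simp; norm_num
    simp only [hr]; linarith
  have hr_one : ∀ j, r j ≤ 1 := by
    intro j
    have : 0 ≤ (j : ℝ) * (8 * δ / W) := by positivity
    simp only [hr]; linarith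
  have hlt : ∀ i ∈ Finset.range (J + 1), ∀ j ∈ Finset.range (J + 1), i < j →
      Disjoint (AffineMap.homothety b (r i) '' S) (AffineMap.homothety b (r j) '' S) := by
    intro i hi j hj hij
    rw [Set.disjoint_left]
    rintro _ ⟨x, hx, rfl⟩ ⟨x', hx', hxx'⟩
    have hcoord := congrArg (fun z : 𝔼 => |z l - b l|) hxx'
    simp only [homothety_coord, add_sub_cancel_right, abs_mul] at hcoord
    have hri := hr_half i hi
    have hrj := hr_half j hj
    rw [abs_of_nonneg (a := r j) (by linarith), abs_of_nonneg (a := r i) (by linarith)] at hcoord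
    have hij' : (i : ℝ) + 1 ≤ j := by exact_mod_cast hij
    have hdiff : 8 * δ / W ≤ r i - r j := by
      have : (1 : ℝ) * (8 * δ / W) ≤ (j - i) * (8 * δ / W) := by gcongr; linarith
      simp only [hr]; linarith
    obtain ⟨h1, -⟩ := hA x hx
    obtain ⟨-, h2⟩ := hA x' hx'
    have hA4 : W / 4 ≤ |x l - b l| := by linarith
    -- Consecutive ratios differ by `8 * δ / W` and the slab is at least `W / 4` away from `b`, so
    -- the copies are shifted by `2 * δ`, more than the thickness `δ`.
    have e1 : 2 * δ ≤ (r i - r j) * |x l - b l| := by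
      calc 2 * δ = 8 * δ / W * (W / 4) := by field_simp; norm_num
        _ ≤ _ := by
          gcongr
          exact le_trans (by positivity) hdiff
    have e2 : r j * (|x' l - b l| - |x l - b l|) ≤ δ := by
      have hj1 := hr_one j
      nlinarith
    nlinarith
  have hdisj : (↑(Finset.range (J + 1)) : Set ℕ).PairwiseDisjoint
      (fun j => AffineMap.homothety b (r j) '' S) := by
    intro i hi j hj hij
    rcases lt_or_gt_of_ne hij with h | h
    · exact hlt i hi j hj h
    · exact (hlt j hj i hi h).symm
  have hsub : ∀ j ∈ Finset.range (J + 1), AffineMap.homothety b (r j) '' S ⊆ K := by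
    rintro j hj _ ⟨x, hx, rfl⟩
    rw [AffineMap.homothety_eq_lineMap, AffineMap.lineMap_apply_module]
    exact hc hb (hSK hx) (by linarith [hr_one j]) (by linarith [hr_half j hj]) (by ring)
  have hmeas : ∀ j ∈ Finset.range (J + 1),
      MeasurableSet (AffineMap.homothety b (r j) '' S) := by
    intro j hj
    have hrj : r j ≠ 0 := by linarith [hr_half j hj]
    exact ((AffineMap.homothety_continuous b (r j)).measurableEmbedding
      (AffineEquiv.homothetyUnitsMulHom b (Units.mk0 _ hrj)).injective).measurableSet_image.2 hS
  have hunion := measureReal_biUnion_finset (μ := volume) hdisj hmeas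
    (fun j hj => ((measure_mono (hsub j hj)).trans_lt hK.measure_lt_top).ne)
  have hle : ∑ j ∈ Finset.range (J + 1), volume.real (AffineMap.homothety b (r j) '' S) ≤
      volume.real K := by
    rw [← hunion]
    exact measureReal_mono (Set.iUnion₂_subset hsub) hK.measure_lt_top.ne
  have hterm : ∀ j ∈ Finset.range (J + 1),
      (1 / 2) ^ d * volume.real S ≤ volume.real (AffineMap.homothety b (r j) '' S) := by
    intro j hj
    have := hr_half j hj
    rw [volume_real_image_homothety b (by linarith)]
    gcongr
  have hsum := Finset.card_nsmul_le_sum _ _ _ hterm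
  rw [Finset.card_range, nsmul_eq_mul] at hsum
  push_cast at hsum
  have hfin := hsum.trans hle
  have h3 : W / (16 * δ) * ((1 / 2) ^ d * volume.real S) ≤ volume.real K := by
    refine le_trans ?_ hfin
    gcongr
  calc W * volume.real S = 16 * 2 ^ d * δ * (W / (16 * δ) * ((1 / 2) ^ d * volume.real S)) := by
        rw [one_div, inv_pow]; field_simp
    _ ≤ _ := by gcongr

/-- A slab of small width has a small share of the volume of a convex body. -/
lemma volume_slab_le {K S : Set 𝔼} (hK : IsCompact K) (hc : Convex ℝ K) (hSK : S ⊆ K)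
    (hS : MeasurableSet S) (l : Fin d) {α δ : ℝ} (hδ : 0 < δ)
    (hslab : ∀ x ∈ S, α ≤ x l ∧ x l ≤ α + δ) :
    coordWidth K l * volume.real S ≤ 16 * 2 ^ d * δ * volume.real K := by
  rcases S.eq_empty_or_nonempty with rfl | hne
  · simp; positivity
  have hKne := hne.mono hSK
  obtain ⟨a, ha, b, hb, hab, hw⟩ := exists_coordWidth_eq hK hKne l
  set W := coordWidth K l with hWdef
  have hpow : (1 : ℝ) ≤ 2 ^ d := one_le_pow₀ one_le_two
  rcases le_or_gt W (2 * δ) with hsmall | hlarge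
  · have hmono : volume.real S ≤ volume.real K := measureReal_mono hSK hK.measure_lt_top.ne
    have : 2 * δ ≤ 16 * 2 ^ d * δ := by nlinarith
    gcongr
    linarith
  have hW : 0 < W := by linarith
  -- The centre is the end of `K` farther from the middle of the slab. The slab is then at least `W
  -- / 2 - δ / 2` away from it, and this is at least `W / 4` since `2 * δ < W`.
  rcases le_total (α + δ / 2) ((a l + b l) / 2) with hside | hside
  · refine volume_slab_le_of_far hK hc hSK hS l hb (A := b l - (α + δ)) hδ hW (by linarith) ?_
    intro x hx
    have h1 := hslab x hx
    have h2 := hab x (hSK hx)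
    rw [abs_of_nonpos (by linarith)]
    constructor <;> linarith
  · refine volume_slab_le_of_far hK hc hSK hS l ha (A := α - a l) hδ hW (by linarith) ?_
    intro x hx
    have h1 := hslab x hx
    have h2 := hab x (hSK hx)
    rw [abs_of_nonneg (by linarith)]
    constructor <;> linarith

/-! ### Sample points of a body with an inscribed ball -/

/-- If the points of `X` fill `Ω` and `v` has all those in the interior of the convex body `K`, then
`v` has points near every point of `K` that has been moved inwards. -/
lemma exists_mem_dist_le {Ω K : Set 𝔼} {X v : Finset 𝔼} {h R t : ℝ}
    (hfill : ∀ z ∈ Ω, ∃ x ∈ X, dist z x ≤ h) (hc : Convex ℝ K)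
    (hKΩ : K ⊆ Ω) (hXv : ∀ x ∈ X, x ∈ interior K → x ∈ v) {y a : 𝔼} (hy : closedBall y R ⊆ K)
    (hR : 0 ≤ R) (ha : a ∈ K) (ht₀ : 0 < t) (ht₁ : t ≤ 1) (hhR : h < t * R) :
    ∃ x ∈ v, dist ((1 - t) • a + t • y) x ≤ h := by
  have hz : (1 - t) • a + t • y ∈ K :=
    hc ha (hy (mem_closedBall_self hR)) (by linarith) ht₀.le (by ring)
  obtain ⟨x, hx, hzx⟩ := hfill _ (hKΩ hz)
  refine ⟨x, hXv x hx ?_, hzx⟩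
  rw [mem_interior]
  refine ⟨ball ((1 - t) • a + t • y) (t * R), fun u hu => ?_, isOpen_ball, ?_⟩
  · set z := (1 - t) • a + t • y with hzdef
    have hu' : y + t⁻¹ • (u - z) ∈ closedBall y R := by
      rw [mem_ball, dist_eq_norm] at hu
      rw [mem_closedBall, dist_eq_norm, add_sub_cancel_left, norm_smul, norm_inv,
        Real.norm_eq_abs, abs_of_pos ht₀, inv_mul_le_iff₀ ht₀]
      exact hu.le
    have : u = (1 - t) • a + t • (y + t⁻¹ • (u - z)) := by
      rw [smul_add, smul_inv_smul₀ ht₀.ne', ← add_assoc, ← hzdef, add_sub_cancel]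
    rw [this]
    exact hc ha (hy hu') (by linarith) ht₀.le (by ring)
  · rw [mem_ball, dist_comm]
    linarith

/-- The number of points in a convex body is at least proportional to its volume. -/
lemma volume_le_card_mul_of_closedBall_subset {Ω K : Set 𝔼} {X v : Finset 𝔼} {h R : ℝ}
    (hh : 0 < h) (hfill : ∀ z ∈ Ω, ∃ x ∈ X, dist z x ≤ h) (hc : Convex ℝ K)
    (hKΩ : K ⊆ Ω) (hXv : ∀ x ∈ X, x ∈ interior K → x ∈ v) {y : 𝔼} (hy : closedBall y R ⊆ K)
    (hR : 4 * h ≤ R) :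
    volume.real K ≤ v.card * ((2 * h) ^ d * volume.real (ball (0 : 𝔼) 1)) := by
  -- Only the half-size copy of `K` is sure to be covered by balls around `v` itself: near the
  -- boundary of `K` the closest sample point may lie outside.
  have hcov : ∀ z ∈ AffineMap.homothety y (1 / 2 : ℝ) '' K, ∃ x ∈ v, dist z x ≤ h := by
    rintro _ ⟨w, hw, rfl⟩
    obtain ⟨x, hx, hwx⟩ := exists_mem_dist_le (t := 1 / 2) hfill hc hKΩ hXv hy (by linarith) hw
      (by norm_num) (by norm_num) (by linarith)
    refine ⟨x, hx, ?_⟩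
    rw [AffineMap.homothety_eq_lineMap, AffineMap.lineMap_apply_module]
    convert hwx using 2
    module
  have := volume_le_card_mul hh.le hcov
  rw [volume_real_image_homothety y (by norm_num)] at this
  calc volume.real K = 2 ^ d * ((1 / 2) ^ d * volume.real K) := by
        rw [← mul_assoc, ← mul_pow]; norm_num
    _ ≤ 2 ^ d * (v.card * (h ^ d * volume.real (ball (0 : 𝔼) 1))) := by gcongr
    _ = _ := by rw [mul_pow]; ring

/-! ### Cells of clusters and their behaviour under a split -/

/-- `X` is a subset of `Ω` with separation radius at least `q` and fill distance at most `c * q`. -/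
structure IsSampling (Ω : Set (EuclideanSpace ℝ (Fin d))) (X : Finset (EuclideanSpace ℝ (Fin d)))
    (c q : ℝ) : Prop where
  pos : 0 < q
  one_le : 1 ≤ c
  subset : (X : Set (EuclideanSpace ℝ (Fin d))) ⊆ Ω
  sep : ∀ x ∈ X, ∀ y ∈ X, x ≠ y → 2 * q ≤ dist x y
  fill : ∀ z ∈ Ω, ∃ x ∈ X, dist z x ≤ c * q

/-- The convex body `K` belongs to the cluster `v`: it is a box section of `Ω` that contains `v`,
its interior contains no other points of `X`, and it is anchored unless it is small. -/
structure IsCell (Ω : Set (EuclideanSpace ℝ (Fin d))) (X : Finset (EuclideanSpace ℝ (Fin d)))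
    (c₀ w₀ : ℝ) (v : Finset (EuclideanSpace ℝ (Fin d))) (K : Set (EuclideanSpace ℝ (Fin d))) :
    Prop where
  nonempty : v.Nonempty
  subset_sample : v ⊆ X
  subset : (v : Set (EuclideanSpace ℝ (Fin d))) ⊆ K
  convex : Convex ℝ K
  isCompact : IsCompact K
  isSection : IsSection ∅ Ω K
  mem_of_interior : ∀ x ∈ X, x ∈ interior K → x ∈ v
  anchored_or : Anchored c₀ K ∨ ∀ k, coordWidth K k ≤ w₀

lemma IsCell.nonempty_body {Ω K : Set 𝔼} {X v : Finset 𝔼} {c₀ w₀ : ℝ}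
    (h : IsCell Ω X c₀ w₀ v K) : K.Nonempty :=
  (show (v : Set 𝔼).Nonempty from h.nonempty).mono h.subset

lemma two_mul_le_coordWidth {K : Set 𝔼} (hK : IsCompact K) {y : 𝔼} {R : ℝ} (hR : 0 ≤ R)
    (hy : closedBall y R ⊆ K) (k : Fin d) : 2 * R ≤ coordWidth K k := by
  have h1 : y + EuclideanSpace.single k R ∈ K := hy (by simp [abs_of_nonneg hR])
  have h2 : y - EuclideanSpace.single k R ∈ K := hy (by simp [abs_of_nonneg hR])
  have := sub_le_coordWidth hK k h1 h2
  simp at this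
  linarith

/-- A body that contains a large ball is at most twice as wide as the set of its sample points. -/
lemma coordWidth_le_two_mul {Ω K : Set 𝔼} {X v : Finset 𝔼} {h R : ℝ} (hh : 0 < h)
    (hfill : ∀ z ∈ Ω, ∃ x ∈ X, dist z x ≤ h) (hc : Convex ℝ K) (hK : IsCompact K)
    (hKΩ : K ⊆ Ω) (hXv : ∀ x ∈ X, x ∈ interior K → x ∈ v) {y : 𝔼} (hy : closedBall y R ⊆ K)
    (hR : 16 * h ≤ R) (k : Fin d) : coordWidth K k ≤ 2 * coordWidth (v : Set 𝔼) k := by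
  have hR0 : 0 < R := by linarith
  have hyK : y ∈ K := hy (mem_closedBall_self hR0.le)
  have hwide := two_mul_le_coordWidth hK hR0.le hy k
  obtain ⟨a, ha, b, hb, -, hw⟩ := exists_coordWidth_eq hK ⟨y, hyK⟩ k
  -- Moving an extreme point inwards by `1 / 8` costs at most `h` plus an eighth of the width at
  -- each end. Since the width is at least `32 * h`, less than half of it is lost in all.
  have near : ∀ e ∈ K, ∃ x ∈ v, |x k - e k| ≤ h + 1 / 8 * coordWidth K k := by
    intro e he
    obtain ⟨x, hx, hxe⟩ := exists_mem_dist_le (t := 1 / 8) hfill hc hKΩ hXv hy hR0.le he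
      (by norm_num) (by norm_num) (by linarith)
    refine ⟨x, hx, ?_⟩
    have h1 := abs_coord_sub_le_dist x ((1 - (1 / 8 : ℝ)) • e + (1 / 8 : ℝ) • y) k
    have h2 := abs_sub_le_coordWidth hK k hyK he
    rw [dist_comm] at h1
    simp only [PiLp.add_apply, PiLp.smul_apply, smul_eq_mul] at h1
    rw [abs_le] at *
    constructor <;> linarith [h1.1, h1.2, h2.1, h2.2]
  obtain ⟨x, hx, hxa⟩ := near a ha
  obtain ⟨x', hx', hxb⟩ := near b hb
  have := sub_le_coordWidth v.finite_toSet.isCompact k (x := x') (y := x) hx' hx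
  rw [abs_le] at hxa hxb
  linarith [hxa.2, hxb.1]

/-- A cut along a coordinate outside `S` keeps the anchor of `S`: bracketing in the smaller set
forces the `l`-th coordinate between two elements of the interval `I`. -/
lemma IsSection.inter_coord {S : Finset (Fin d)} {K' K : Set 𝔼} (h : IsSection S K' K) {l : Fin d}
    (hl : l ∉ S) {I : Set ℝ} (hI : I.OrdConnected) :
    IsSection S K' (K ∩ {x | x l ∈ I}) := by
  refine ⟨Set.inter_subset_left.trans h.1, fun x hx hbr => ?_⟩
  refine ⟨h.2 x hx fun k hk => (hbr k hk).mono Set.inter_subset_left, ?_⟩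
  obtain ⟨y, hy, z, hz, h1, h2⟩ := hbr l hl
  exact hI.out hy.2 hz.2 ⟨h1, h2⟩

lemma isSection_self (S : Finset (Fin d)) (K : Set 𝔼) : IsSection S K K :=
  ⟨subset_rfl, fun _ hx _ => hx⟩

/-- Coordinate projections are open, so sample points interior to a half-cell lie strictly on one
side of the median, where the assignment to a son is unambiguous. -/
lemma coord_mem_interior {K : Set 𝔼} {l : Fin d} {I : Set ℝ} {x : 𝔼}
    (hx : x ∈ interior (K ∩ {x | x l ∈ I})) : x l ∈ interior I := by
  have hopen : IsOpenMap (fun x : 𝔼 => x l) :=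
    (isOpenMap_eval l).comp (EuclideanSpace.equiv (Fin d) ℝ).toHomeomorph.isOpenMap
  have : (fun x : 𝔼 => x l) '' interior (K ∩ {x | x l ∈ I}) ⊆ interior I :=
    interior_maximal (by rintro _ ⟨z, hz, rfl⟩; exact (interior_subset hz).2)
      (hopen _ isOpen_interior)
  exact this ⟨x, hx, rfl⟩

/-- A part of a body with nearly half of the sample points is not thin. -/
lemma coordWidth_le_of_card_le {Ω K K₁ : Set 𝔼} {X v v₁ : Finset 𝔼} {c q R : ℝ}
    (hX : IsSampling Ω X c q) (hvX : v ⊆ X) (hc : Convex ℝ K) (hK : IsCompact K)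
    (hKΩ : K ⊆ Ω) (hXv : ∀ x ∈ X, x ∈ interior K → x ∈ v) {y : 𝔼} (hy : closedBall y R ⊆ K)
    (hR : 16 * (c * q) ≤ R) (hd : 0 < d) (hK₁ : IsCompact K₁) (hK₁K : K₁ ⊆ K) (hv₁ : v₁.Nonempty)
    (hv₁v : v₁ ⊆ v) (hv₁K : (v₁ : Set 𝔼) ⊆ K₁) (hcard : v.card ≤ 2 * v₁.card + 2) (l : Fin d) :
    coordWidth K l ≤ 32 * (8 * c) ^ d * (coordWidth K₁ l + 2 * q) := by
  have hq := hX.pos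
  have hc1 := hX.one_le
  have hqc : q ≤ c * q := le_mul_of_one_le_left hq.le hc1
  have hR0 : 0 < R := by linarith
  set ω := volume.real (ball (0 : 𝔼) 1) with hω
  have hω0 : 0 < ω := volume_real_ball_pos
  have hvol : volume.real K ≤ v.card * ((2 * (c * q)) ^ d * ω) :=
    volume_le_card_mul_of_closedBall_subset (by linarith) hX.fill hc hKΩ hXv hy (by linarith)
  -- Enough points to absorb the additive `2` in `hcard`.
  have hcard8 : (8 : ℝ) ≤ v.card := by
    have h1 : R ^ d * ω ≤ volume.real K := by
      rw [hω, ← volume_real_closedBall y hR0.le]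
      exact measureReal_mono hy hK.measure_lt_top.ne
    have h2 : (8 : ℝ) ^ d * (2 * (c * q)) ^ d ≤ R ^ d := by
      rw [← mul_pow]
      gcongr
      linarith
    have h3 : (8 : ℝ) ≤ 8 ^ d := le_self_pow₀ (by norm_num) hd.ne'
    have hpos : 0 < (2 * (c * q)) ^ d * ω := by positivity
    refine le_of_mul_le_mul_right ?_ hpos
    calc (8 : ℝ) * ((2 * (c * q)) ^ d * ω) ≤ 8 ^ d * ((2 * (c * q)) ^ d * ω) := by gcongr
      _ = 8 ^ d * (2 * (c * q)) ^ d * ω := by ring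
      _ ≤ R ^ d * ω := by gcongr
      _ ≤ _ := h1.trans hvol
  have hcard4 : (v.card : ℝ) ≤ 4 * v₁.card := by
    have : (v.card : ℝ) ≤ 2 * v₁.card + 2 := by exact_mod_cast hcard
    linarith
  obtain ⟨a, ha, b, hb, hab, hw⟩ :=
    exists_coordWidth_eq hK₁ ((show (v₁ : Set 𝔼).Nonempty from hv₁).mono hv₁K) l
  have hw₁ : 0 ≤ coordWidth K₁ l := coordWidth_nonneg hK₁ ⟨a, ha⟩ l
  -- The `q`-balls around `v₁` may leave `K`; the copy doubled about `y` contains them because `q ≤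
  -- R`.
  set K₂ : Set 𝔼 := AffineMap.homothety y (2 : ℝ) '' K with hK₂
  have hK₂c : IsCompact K₂ := hK.image (AffineMap.homothety_continuous y (2 : ℝ))
  have hK₂conv : Convex ℝ K₂ := hc.affine_image _
  set U : Set 𝔼 := K₂ ∩ {x | a l - q ≤ x l ∧ x l ≤ a l - q + (coordWidth K₁ l + 2 * q)} with hU
  have hUmeas : MeasurableSet U := by
    refine hK₂c.measurableSet.inter (IsClosed.measurableSet ?_)
    exact (isClosed_le continuous_const (continuous_coord l)).inter
      (isClosed_le (continuous_coord l) continuous_const)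
  have hpack : v₁.card * (q ^ d * ω) ≤ volume.real U := by
    refine card_mul_le_volume hq
      (fun x hx z hz => hX.sep x (hvX (hv₁v hx)) z (hvX (hv₁v hz)))
      ((measure_mono Set.inter_subset_left).trans_lt hK₂c.measure_lt_top).ne ?_
    intro x hx z hz
    have hxK₁ := hv₁K hx
    have hz' := mem_ball.1 hz
    refine ⟨⟨(1 / 2 : ℝ) • x + (1 / 2 : ℝ) • (y + (z - x)), ?_, ?_⟩, ?_, ?_⟩
    · refine hc (hK₁K hxK₁) (hy ?_) (by norm_num) (by norm_num) (by norm_num)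
      rw [mem_closedBall, dist_eq_norm, add_sub_cancel_left, ← dist_eq_norm]
      linarith
    · rw [AffineMap.homothety_eq_lineMap, AffineMap.lineMap_apply_module]
      module
    · have := (abs_le.1 (abs_coord_sub_le_dist z x l)).1
      linarith [(hab x hxK₁).1]
    · have := (abs_le.1 (abs_coord_sub_le_dist z x l)).2
      linarith [(hab x hxK₁).2]
  have hslab := volume_slab_le hK₂c hK₂conv (S := U) Set.inter_subset_left hUmeas l
    (α := a l - q) (δ := coordWidth K₁ l + 2 * q) (by linarith) (fun x hx => hx.2)
  rw [hK₂, volume_real_image_homothety y (by norm_num), ← hK₂] at hslab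
  have hwK₂ : 2 * coordWidth K l ≤ coordWidth K₂ l := by
    obtain ⟨a', ha', b', hb', -, hw'⟩ :=
      exists_coordWidth_eq hK ⟨y, hy (mem_closedBall_self hR0.le)⟩ l
    have := sub_le_coordWidth hK₂c l (Set.mem_image_of_mem _ hb') (Set.mem_image_of_mem _ ha')
    rw [homothety_coord, homothety_coord] at this
    linarith
  have hWK : 0 ≤ coordWidth K l := coordWidth_nonneg hK ⟨a, hK₁K ha⟩ l
  have hv₁pos : (0 : ℝ) < v₁.card := by exact_mod_cast hv₁.card_pos
  refine le_of_mul_le_mul_right ?_ (by positivity : 0 < 2 * (v₁.card * (q ^ d * ω)))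
  calc coordWidth K l * (2 * (v₁.card * (q ^ d * ω)))
      = 2 * coordWidth K l * (v₁.card * (q ^ d * ω)) := by ring
    _ ≤ coordWidth K₂ l * volume.real U := by
        gcongr
        exact le_trans (by positivity) hwK₂
    _ ≤ _ := hslab
    _ ≤ 16 * 2 ^ d * (coordWidth K₁ l + 2 * q) *
          (2 ^ d * (4 * v₁.card * ((2 * (c * q)) ^ d * ω))) := by
        gcongr
        exact hvol.trans (by gcongr)
    _ = _ := by
        rw [show (8 : ℝ) * c = 2 * 2 * 2 * c by ring]
        simp only [mul_pow]
        ring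

/-- The parameters from which the body of a cluster is anchored as long as it is not small. -/
structure IsThreshold (d : ℕ) (r₀ D c q c₀ w₀ : ℝ) : Prop where
  pos : 0 < c₀
  le_one : c₀ ≤ 1
  mul_le : c₀ * (4 * (32 * (8 * c) ^ d)) ≤ 1
  ball_le : 16 * (c * q) ≤ r₀ / (4 * d * D) * ((c₀ / (2 * d)) ^ d * w₀)
  width_le : 8 * (32 * (8 * c) ^ d) * q ≤ w₀

/-- For a cell wider than `w₀` the aspect bound turns one large width into a lower bound for all of
them, hence into an inscribed ball. The choice of `w₀` makes its radius at least `16 * (c * q)`, as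
the counting lemmas require. -/
lemma IsCell.exists_closedBall {Ω K : Set 𝔼} {X v : Finset 𝔼} {x₀ : 𝔼} {r₀ D c q c₀ w₀ : ℝ}
    (hd : 0 < d) (hΩ : Convex ℝ Ω) (hr : 0 < r₀) (hD : 0 < D) (hball : closedBall x₀ r₀ ⊆ Ω)
    (hΩD : Ω ⊆ closedBall x₀ D) (ht : IsThreshold d r₀ D c q c₀ w₀)
    (hcell : IsCell Ω X c₀ w₀ v K) (hA : Anchored c₀ K) {l : Fin d} (hl : w₀ < coordWidth K l)
    (hw₀ : 0 ≤ w₀) :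
    ∃ y, closedBall y (r₀ / (4 * d * D) * ((c₀ / (2 * d)) ^ d * coordWidth K l)) ⊆ K ∧
      16 * (c * q) ≤ r₀ / (4 * d * D) * ((c₀ / (2 * d)) ^ d * coordWidth K l) := by
  have hd' : (0 : ℝ) < d := by exact_mod_cast hd
  have hc₀ := ht.pos
  obtain ⟨y, hy⟩ := exists_closedBall_subset hd hΩ hball hΩD hcell.isCompact hcell.convex
    hcell.nonempty_body hcell.isSection (m := (c₀ / (2 * d)) ^ d * coordWidth K l)
    (mul_pos (by positivity) (hw₀.trans_lt hl))
    (fun k => hA.aspect hd hcell.isCompact hcell.convex hcell.nonempty_body ht.pos ht.le_one k l)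
  refine ⟨y, hy, ht.ball_le.trans ?_⟩
  gcongr

/-- The inductive step. In a large cell the points of `v` reach across at least half of each width,
so a longest edge of the box of `v` is nearly a widest direction of `K`, and the thin-slab bound
keeps the half-cell wide along it. -/
lemma IsCell.half {Ω K : Set 𝔼} {X v v₁ : Finset 𝔼} {x₀ : 𝔼} {r₀ D c q c₀ w₀ : ℝ}
    (hX : IsSampling Ω X c q) (hΩ : Convex ℝ Ω) (hr : 0 < r₀) (hD : 0 < D)
    (hball : closedBall x₀ r₀ ⊆ Ω) (hΩD : Ω ⊆ closedBall x₀ D)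
    (ht : IsThreshold d r₀ D c q c₀ w₀) (hcell : IsCell Ω X c₀ w₀ v K) {l : Fin d}
    (hl : ∀ i, coordWidth (v : Set 𝔼) i ≤ coordWidth (v : Set 𝔼) l) {I : Set ℝ}
    (hI : I.OrdConnected) (hIc : IsClosed I) (hv₁ : v₁.Nonempty) (hv₁v : v₁ ⊆ v)
    (hv₁I : ∀ x ∈ v₁, x l ∈ I) (hmem : ∀ x ∈ v, x l ∈ interior I → x ∈ v₁)
    (hcard : v.card ≤ 2 * v₁.card + 2) : IsCell Ω X c₀ w₀ v₁ (K ∩ {x | x l ∈ I}) := by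
  have hd : 0 < d := l.pos
  set K₁ : Set 𝔼 := K ∩ {x | x l ∈ I} with hK₁
  have hK₁c : IsCompact K₁ := hcell.isCompact.inter_right (hIc.preimage (continuous_coord l))
  have hK₁conv : Convex ℝ K₁ := hcell.convex.inter
    (hI.convex.is_linear_preimage (f := fun x : 𝔼 => x l) ⟨fun _ _ => rfl, fun _ _ => rfl⟩)
  have hv₁K : (v₁ : Set 𝔼) ⊆ K₁ := fun x hx => ⟨hcell.subset (hv₁v hx), hv₁I x hx⟩
  have hne : K₁.Nonempty := (show (v₁ : Set 𝔼).Nonempty from hv₁).mono hv₁K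
  have hmono := coordWidth_mono hK₁c hne hcell.isCompact Set.inter_subset_left
  have hG : 0 < 32 * (8 * c) ^ d := by have := hX.one_le; positivity
  have hw₀ : 0 ≤ w₀ := le_trans (by have := hX.pos; positivity) ht.width_le
  refine ⟨hv₁, hv₁v.trans hcell.subset_sample, hv₁K, hK₁conv, hK₁c,
    hcell.isSection.inter_coord (by simp) hI, fun x hx hxi => ?_, ?_⟩
  · exact hmem x (hcell.mem_of_interior x hx (interior_mono Set.inter_subset_left hxi))
      (coord_mem_interior hxi)
  by_cases hsmall : ∀ k, coordWidth K k ≤ w₀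
  · exact Or.inr fun k => (hmono k).trans (hsmall k)
  have hA : Anchored c₀ K := hcell.anchored_or.resolve_right hsmall
  push Not at hsmall
  obtain ⟨i, hi⟩ := hsmall
  obtain ⟨y, hy, hR⟩ := hcell.exists_closedBall hd hΩ hr hD hball hΩD ht hA hi hw₀
  have hthin := coordWidth_le_of_card_le hX hcell.subset_sample hcell.convex hcell.isCompact
    hcell.isSection.1 hcell.mem_of_interior hy hR hd hK₁c Set.inter_subset_left hv₁ hv₁v hv₁K
    hcard l
  have hdouble : ∀ k, coordWidth K k ≤ 2 * coordWidth K l := fun k =>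
    (coordWidth_le_two_mul (mul_pos (by linarith [hX.one_le]) hX.pos) hX.fill hcell.convex
      hcell.isCompact hcell.isSection.1 hcell.mem_of_interior hy hR k).trans
      (by
        have h1 := hl k
        have h2 := coordWidth_mono v.finite_toSet.isCompact hcell.nonempty hcell.isCompact
          hcell.subset l
        linarith)
  set G := 32 * (8 * c) ^ d with hGdef
  -- Hence the `2 * q` in `hthin` accounts for at most half of `coordWidth K l`.
  have hwide : 4 * G * q ≤ coordWidth K l := by
    have := ht.width_le
    linarith [hdouble i]
  have hl₁ : coordWidth K l ≤ 2 * G * coordWidth K₁ l := by nlinarith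
  refine Or.inl fun S hS => ?_
  -- A cut along a direction in `S` renews the anchor of `S` with the half-cell itself; any other
  -- cut leaves the old anchor valid.
  by_cases hlS : l ∈ S
  · refine ⟨l, hlS, K₁, hK₁conv, hK₁c, isSection_self S K₁, fun k => ?_⟩
    have hw1 := coordWidth_nonneg hK₁c hne l
    calc c₀ * coordWidth K₁ k ≤ c₀ * (2 * (2 * G * coordWidth K₁ l)) := by
          have := ht.pos
          gcongr
          linarith [hmono k, hdouble k]
      _ = c₀ * (4 * G) * coordWidth K₁ l := by ring
      _ ≤ 1 * coordWidth K₁ l := by gcongr; exact ht.mul_le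
      _ = _ := one_mul _
  · obtain ⟨j, hj, K', h1, h2, h3, h4⟩ := hA S hS
    exact ⟨j, hj, K', h1, h2, h3.inter_coord hlS hI, h4⟩

/-! ### Induction over the tree and cluster sizes -/

lemma IsMedianSplit.union_eq {v v₁ v₂ : Finset 𝔼} (h : IsMedianSplit v v₁ v₂) :
    ∀ x, x ∈ v ↔ x ∈ v₁ ∨ x ∈ v₂ := fun x => by
  have := h.2.2.2.1
  rw [← Finset.mem_coe, ← this]
  simp

lemma IsMedianSplit.card_eq {v v₁ v₂ : Finset 𝔼} (h : IsMedianSplit v v₁ v₂) :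
    v.card = v₁.card + v₂.card := by
  classical
  rw [← Finset.card_union_of_disjoint h.2.2.1]
  congr 1
  ext x
  rw [h.union_eq, Finset.mem_union]

/-- All clusters of a median-split tree have cells if the root has one. -/
lemma exists_isCell_of_hasCluster {Ω : Set 𝔼} {X : Finset 𝔼} {x₀ : 𝔼} {r₀ D c q c₀ w₀ : ℝ}
    (hX : IsSampling Ω X c q) (hΩ : Convex ℝ Ω) (hr : 0 < r₀) (hD : 0 < D)
    (hball : closedBall x₀ r₀ ⊆ Ω) (hΩD : Ω ⊆ closedBall x₀ D)
    (ht : IsThreshold d r₀ D c q c₀ w₀) :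
    ∀ (T : ClusterTree 𝔼) (K : Set 𝔼), T.IsMedianSplitTree → IsCell Ω X c₀ w₀ T.root K →
      ∀ (j : ℕ) (w : Finset 𝔼), T.HasCluster j w → ∃ K', IsCell Ω X c₀ w₀ w K' := by
  intro T
  induction T with
  | leaf v =>
    intro K _ hK j w hw
    cases j with
    | zero =>
      obtain rfl : w = v := hw
      exact ⟨K, hK⟩
    | succ j => exact hw.elim
  | node v s t ihs iht =>
    intro K hT hK j w hw
    cases j with
    | zero =>
      obtain rfl : w = v := hw
      exact ⟨K, hK⟩
    | succ j =>
      obtain ⟨hsplit, hs, htt⟩ := hT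
      have hmem := hsplit.union_eq
      have hcard := hsplit.card_eq
      change v.card = _ at hcard
      obtain ⟨hne₁, hne₂, -, -, h12, h21, l, m, hl, -, hge, hle⟩ := hsplit
      rcases hw with hw | hw
      · refine ihs (K ∩ {x | x l ∈ Set.Ici m}) hs ?_ j w hw
        refine IsCell.half hX hΩ hr hD hball hΩD ht hK hl Set.ordConnected_Ici isClosed_Ici hne₁
          (fun x hx => (hmem x).2 (Or.inl hx)) hge (fun x hx hxm => ?_)
          (show v.card ≤ _ by omega)
        rw [interior_Ici] at hxm
        exact ((hmem x).1 hx).resolve_right fun h => (hle x h).not_gt hxm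
      · refine iht (K ∩ {x | x l ∈ Set.Iic m}) htt ?_ j w hw
        refine IsCell.half hX hΩ hr hD hball hΩD ht hK hl Set.ordConnected_Iic isClosed_Iic hne₂
          (fun x hx => (hmem x).2 (Or.inr hx)) hle (fun x hx hxm => ?_)
          (show v.card ≤ _ by omega)
        rw [interior_Iic] at hxm
        exact ((hmem x).1 hx).resolve_left fun h => (hge x h).not_gt hxm

/-- A split into parts differing by at most two gives `|v| + 2 ≤ 2 * (|v₁| + 2)`, and likewise for
`v₂`. -/
lemma card_root_add_two_le :
    ∀ (T : ClusterTree 𝔼), T.IsMedianSplitTree → ∀ (j : ℕ) (w : Finset 𝔼), T.HasCluster j w →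
      T.root.card + 2 ≤ 2 ^ j * (w.card + 2) := by
  intro T
  induction T with
  | leaf v =>
    intro _ j w hw
    cases j with
    | zero =>
      obtain rfl : w = v := hw
      simp [ClusterTree.root]
    | succ j => exact hw.elim
  | node v s t ihs iht =>
    intro hT j w hw
    cases j with
    | zero =>
      obtain rfl : w = v := hw
      simp [ClusterTree.root]
    | succ j =>
      obtain ⟨hsplit, hs, htt⟩ := hT
      have hcard := hsplit.card_eq
      obtain ⟨-, -, -, -, h12, h21, -⟩ := hsplit
      rw [pow_succ]
      rcases hw with hw | hw
      · have := ihs hs j w hw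
        simp only [ClusterTree.root] at *
        linarith
      · have := iht htt j w hw
        simp only [ClusterTree.root] at *
        linarith

/-- A function of the size of a cluster that is at least halved by each median split. -/
def sizeWeight (n : ℕ) : ℕ := if 3 ≤ n then 2 * n - 4 else n - 1

/-- The excess `n - 2` is at least halved by such a split but vanishes for pairs. Doubling it for `n
≥ 3` leaves room for the value `1` at `n = 2`, so the weight controls all clusters with two or more
points. -/
lemma two_mul_sizeWeight_le {a b : ℕ} (ha : 0 < a) (hb : 0 < b) (h : a ≤ b + 2) :
    2 * sizeWeight a ≤ sizeWeight (a + b) := by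
  unfold sizeWeight
  split_ifs <;> omega

lemma two_pow_mul_sizeWeight_le :
    ∀ (T : ClusterTree 𝔼), T.IsMedianSplitTree → ∀ (j : ℕ) (w : Finset 𝔼), T.HasCluster j w →
      2 ^ j * sizeWeight w.card ≤ sizeWeight T.root.card := by
  intro T
  induction T with
  | leaf v =>
    intro _ j w hw
    cases j with
    | zero =>
      obtain rfl : w = v := hw
      simp [ClusterTree.root]
    | succ j => exact hw.elim
  | node v s t ihs iht =>
    intro hT j w hw
    cases j with
    | zero =>
      obtain rfl : w = v := hw
      simp [ClusterTree.root]
    | succ j =>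
      obtain ⟨hsplit, hs, htt⟩ := hT
      have hcard := hsplit.card_eq
      obtain ⟨hne₁, hne₂, -, -, h12, h21, -⟩ := hsplit
      rw [pow_succ]
      rcases hw with hw | hw
      · have := ihs hs j w hw
        have h2 := two_mul_sizeWeight_le hne₁.card_pos hne₂.card_pos h12
        simp only [ClusterTree.root] at *
        rw [hcard]
        linarith
      · have := iht htt j w hw
        have h2 := two_mul_sizeWeight_le hne₂.card_pos hne₁.card_pos h21
        simp only [ClusterTree.root] at *
        rw [hcard, add_comm]
        linarith

lemma two_pow_mul_card_le {T : ClusterTree 𝔼} (hT : T.IsMedianSplitTree) {j : ℕ} {w : Finset 𝔼}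
    (hw : T.HasCluster j w) (h2 : 2 ≤ w.card) : 2 ^ j * w.card ≤ 4 * T.root.card := by
  have h := two_pow_mul_sizeWeight_le T hT j w hw
  have h1 : w.card ≤ 2 * sizeWeight w.card := by unfold sizeWeight; split_ifs <;> omega
  have h3 : sizeWeight T.root.card ≤ 2 * T.root.card := by
    unfold sizeWeight; split_ifs <;> omega
  calc 2 ^ j * w.card ≤ 2 ^ j * (2 * sizeWeight w.card) := by gcongr
    _ = 2 * (2 ^ j * sizeWeight w.card) := by ring
    _ ≤ _ := by omega

/-- All widths of `Ω` lie between `2 * r₀` and `2 * D`, so `Ω` serves as its own anchor for every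
`S`. -/
lemma isCell_root {Ω : Set 𝔼} {X : Finset 𝔼} {x₀ : 𝔼} {r₀ D c₀ w₀ : ℝ}
    (hXΩ : (X : Set 𝔼) ⊆ Ω) (hne : X.Nonempty) (hΩ : Convex ℝ Ω) (hΩc : IsCompact Ω)
    (hr : 0 < r₀) (hball : closedBall x₀ r₀ ⊆ Ω) (hΩD : Ω ⊆ closedBall x₀ D) (hc₀ : 0 < c₀)
    (hc₀D : c₀ * D ≤ r₀) : IsCell Ω X c₀ w₀ X Ω := by
  refine ⟨hne, subset_rfl, hXΩ, hΩ, hΩc, isSection_self _ _, fun x hx _ => hx, Or.inl ?_⟩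
  rintro S ⟨i, hi⟩
  refine ⟨i, hi, Ω, hΩ, hΩc, isSection_self _ _, fun k => ?_⟩
  have hΩne : Ω.Nonempty := (show (X : Set 𝔼).Nonempty from hne).mono hXΩ
  obtain ⟨a, ha, b, hb, -, hw⟩ := exists_coordWidth_eq hΩc hΩne k
  have h1 : coordWidth Ω k ≤ 2 * D := by
    rw [hw]
    have h2 := (le_abs_self _).trans (abs_coord_sub_le_dist b a k)
    have h3 := dist_triangle_right b a x₀
    linarith [mem_closedBall.1 (hΩD ha), mem_closedBall.1 (hΩD hb)]
  calc c₀ * coordWidth Ω k ≤ c₀ * (2 * D) := by gcongr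
    _ ≤ 2 * r₀ := by linarith
    _ ≤ _ := two_mul_le_coordWidth hΩc hr.le hball i

/-! ### Widths, cardinalities and diameters -/

/-- The widths of a cell are bounded in terms of the number of its sample points. -/
lemma IsCell.coordWidth_pow_le {Ω K : Set 𝔼} {X v : Finset 𝔼} {x₀ : 𝔼} {r₀ D c q c₀ A : ℝ}
    (hX : IsSampling Ω X c q) (hd : 0 < d) (hΩ : Convex ℝ Ω) (hr : 0 < r₀) (hD : 0 < D)
    (hball : closedBall x₀ r₀ ⊆ Ω) (hΩD : Ω ⊆ closedBall x₀ D) (hA : 0 ≤ A)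
    (ht : IsThreshold d r₀ D c q c₀ (A * q)) (hcell : IsCell Ω X c₀ (A * q) v K)
    {l : Fin d} (hl : ∀ k, coordWidth K k ≤ coordWidth K l) :
    coordWidth K l ^ d ≤
      (A ^ d + (2 * c / (r₀ / (4 * d * D) * (c₀ / (2 * d)) ^ d)) ^ d) * (v.card * q ^ d) := by
  have hq := hX.pos
  have hc1 := hX.one_le
  have hc₀ := ht.pos
  have hd' : (0 : ℝ) < d := by exact_mod_cast hd
  set B := r₀ / (4 * d * D) * (c₀ / (2 * d)) ^ d with hB
  have hB0 : 0 < B := by positivity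
  have hwl := coordWidth_nonneg hcell.isCompact hcell.nonempty_body l
  have hv1 : (1 : ℝ) ≤ v.card := by exact_mod_cast hcell.nonempty.card_pos
  have hsecond : 0 ≤ (2 * c / B) ^ d := by positivity
  -- A small cell has width at most `A * q` and at least one point; in a large one the inscribed
  -- ball gives the count by volume.
  by_cases hsmall : ∀ k, coordWidth K k ≤ A * q
  · calc coordWidth K l ^ d ≤ (A * q) ^ d := by gcongr; exact hsmall l
      _ = A ^ d * (1 * q ^ d) := by rw [mul_pow]; ring
      _ ≤ A ^ d * (v.card * q ^ d) := by gcongr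
      _ ≤ _ := by gcongr; linarith
  · have hAn := hcell.anchored_or.resolve_right hsmall
    push Not at hsmall
    obtain ⟨i, hi⟩ := hsmall
    obtain ⟨y, hy, hR⟩ := hcell.exists_closedBall hd hΩ hr hD hball hΩD ht hAn
      (hi.trans_le (hl i)) (by positivity)
    rw [← mul_assoc (r₀ / (4 * d * D)), ← hB] at hy hR
    have hcq : 0 < c * q := by positivity
    have hvol := volume_le_card_mul_of_closedBall_subset hcq hX.fill hcell.convex
      hcell.isSection.1 hcell.mem_of_interior hy (by linarith)
    have hvol' : (B * coordWidth K l) ^ d * volume.real (ball (0 : 𝔼) 1) ≤ volume.real K := by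
      rw [← volume_real_closedBall y (by positivity)]
      exact measureReal_mono hy hcell.isCompact.measure_lt_top.ne
    have h1 : (B * coordWidth K l) ^ d ≤ v.card * (2 * (c * q)) ^ d := by
      refine le_of_mul_le_mul_right ?_ (volume_real_ball_pos (d := d))
      linarith
    have h2 : coordWidth K l ^ d ≤ (2 * c / B) ^ d * (v.card * q ^ d) := by
      refine le_of_mul_le_mul_left ?_ (by positivity : 0 < B ^ d)
      calc B ^ d * coordWidth K l ^ d = (B * coordWidth K l) ^ d := (mul_pow _ _ _).symm
        _ ≤ _ := h1
        _ = _ := by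
          simp only [div_pow, mul_pow]
          field_simp
    refine h2.trans ?_
    gcongr
    have : 0 ≤ A ^ d := by positivity
    linarith

lemma card_mul_pow_le {V : Finset 𝔼} {q ρ : ℝ} (hq : 0 < q)
    (hsep : ∀ x ∈ V, ∀ y ∈ V, x ≠ y → 2 * q ≤ dist x y) {z : 𝔼}
    (hV : (V : Set 𝔼) ⊆ closedBall z ρ) (hqρ : q ≤ ρ) : V.card * q ^ d ≤ (2 * ρ) ^ d := by
  have h := card_mul_le_volume hq hsep (U := closedBall z (2 * ρ)) measure_closedBall_lt_top.ne
    (fun x hx y hy => by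
      rw [mem_ball] at hy
      rw [mem_closedBall]
      linarith [dist_triangle y x z, mem_closedBall.1 (hV hx)])
  rw [volume_real_closedBall z (by linarith), ← mul_assoc] at h
  exact le_of_mul_le_mul_right h volume_real_ball_pos

lemma subset_boundingBox (v : Finset 𝔼) : (v : Set 𝔼) ⊆ boundingBox v := by
  intro x hx i
  have hb : BddBelow ((fun x : 𝔼 => x i) '' (v : Set 𝔼)) := (v.finite_toSet.image _).bddBelow
  have ha : BddAbove ((fun x : 𝔼 => x i) '' (v : Set 𝔼)) := (v.finite_toSet.image _).bddAbove
  exact ⟨csInf_le hb ⟨x, hx, rfl⟩, le_csSup ha ⟨x, hx, rfl⟩⟩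

lemma dist_le_of_mem_boundingBox {v : Finset 𝔼} {M : ℝ} (hM : 0 ≤ M)
    (h : ∀ k, coordWidth (v : Set 𝔼) k ≤ M) {x y : 𝔼} (hx : x ∈ boundingBox v)
    (hy : y ∈ boundingBox v) : dist x y ≤ d * M := by
  refine dist_le_of_abs_coord_sub_le hM fun k => ?_
  have h1 : coordMax v k - coordMin v k ≤ M := h k
  rw [abs_le]
  constructor <;> linarith [(hx k).1, (hx k).2, (hy k).1, (hy k).2]

lemma diam_boundingBox_le {v : Finset 𝔼} {M : ℝ} (hM : 0 ≤ M)
    (h : ∀ k, coordWidth (v : Set 𝔼) k ≤ M) : diam (boundingBox v) ≤ d * M :=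
  diam_le_of_forall_dist_le (by positivity) fun _ hx _ hy => dist_le_of_mem_boundingBox hM h hx hy

lemma coordWidth_le_diam {v : Finset 𝔼} (hv : v.Nonempty) (k : Fin d) :
    coordWidth (v : Set 𝔼) k ≤ diam (v : Set 𝔼) := by
  obtain ⟨a, ha, b, hb, -, hw⟩ := exists_coordWidth_eq v.finite_toSet.isCompact hv k
  rw [hw]
  exact (le_abs_self _).trans ((abs_coord_sub_le_dist b a k).trans
    (dist_le_diam_of_mem v.finite_toSet.isBounded hb ha))

lemma diam_le_diam_boundingBox {v : Finset 𝔼} (hv : v.Nonempty) :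
    diam (v : Set 𝔼) ≤ diam (boundingBox v) := by
  refine diam_mono (subset_boundingBox v) (isBounded_iff.2 ⟨d * diam (v : Set 𝔼), ?_⟩)
  intro x hx y hy
  exact dist_le_of_mem_boundingBox diam_nonneg (coordWidth_le_diam hv) hx hy

/-- No root of the constant is needed, because `a ≤ C ≤ C ^ n`. -/
lemma le_mul_of_pow_le {n : ℕ} (hn : n ≠ 0) {x y a C : ℝ} (hy : 0 ≤ y)
    (h : x ^ n ≤ a * y ^ n) (hC : 1 ≤ C) (haC : a ≤ C) : x ≤ C * y := by
  refine le_of_pow_le_pow_left₀ hn (by positivity) (h.trans ?_)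
  rw [mul_pow]
  gcongr
  exact haC.trans (le_self_pow₀ hC hn)

/-! ### The comparison on a compact convex body -/

/-- Sizes of the clusters of median-split trees on quasi-uniform samples of a convex body. -/
theorem exists_comparable {Ω : Set 𝔼} (hd : 0 < d) (hΩ : Convex ℝ Ω) (hΩc : IsCompact Ω)
    {x₀ : 𝔼} {r₀ D c : ℝ} (hr : 0 < r₀) (hD : 0 < D) (hball : closedBall x₀ r₀ ⊆ Ω)
    (hΩD : Ω ⊆ closedBall x₀ D) (hc : 1 ≤ c) :
    ∃ C : ℝ, 0 < C ∧ ∀ (X : Finset 𝔼) (q : ℝ), IsSampling Ω X c q →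
      ∀ T : ClusterTree 𝔼, T.root = X → T.IsMedianSplitTree →
      ∀ (j : ℕ) (v : Finset 𝔼), T.HasCluster j v → 2 ≤ v.card →
        Comparable C (diam (v : Set 𝔼)) (diam (boundingBox v)) ∧
        Comparable C (diam (boundingBox v)) ((2 : ℝ) ^ (-(j : ℝ) / (d : ℝ))) := by
  have hd' : (0 : ℝ) < d := by exact_mod_cast hd
  have hd1 : (1 : ℝ) ≤ d := by exact_mod_cast hd
  set G : ℝ := 32 * (8 * c) ^ d with hG
  have hG1 : 1 ≤ G := by
    have : (1 : ℝ) ≤ (8 * c) ^ d := one_le_pow₀ (by linarith)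
    linarith
  -- The first entry is what renewing an anchor after a cut requires, the second what the root
  -- requires.
  set c₀ : ℝ := min (1 / (4 * G)) (r₀ / D) with hc₀
  have hc₀pos : 0 < c₀ := by positivity
  set B : ℝ := r₀ / (4 * d * D) * (c₀ / (2 * d)) ^ d with hB
  have hBpos : 0 < B := by positivity
  -- The first summand makes inscribed balls of large cells have radius at least `16 * (c * q)`; the
  -- second absorbs the collar of width `q` in the thin-slab bound.
  set A : ℝ := 16 * c / B + 8 * G with hA
  have hApos : 0 < A := by positivity
  have hc₀G : c₀ * (4 * G) ≤ 1 := by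
    rw [← le_div_iff₀ (by positivity)]
    exact min_le_left _ _
  have hc₀D : c₀ * D ≤ r₀ := by
    rw [← le_div_iff₀ hD]
    exact min_le_right _ _
  have hthr : ∀ q : ℝ, 0 < q → IsThreshold d r₀ D c q c₀ (A * q) := fun q hq =>
    { pos := hc₀pos
      le_one := by nlinarith
      mul_le := hc₀G
      ball_le := by
        rw [← mul_assoc (r₀ / (4 * d * D)), ← hB]
        calc 16 * (c * q) = B * (16 * c / B * q) := by field_simp
          _ ≤ B * (A * q) := by
            gcongr
            rw [hA]; linarith
      width_le := by
        rw [← hG]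
        gcongr
        have : 0 ≤ 16 * c / B := by positivity
        rw [hA]; linarith }
  set C₁ : ℝ := (A ^ d + (2 * c / B) ^ d) * d ^ d * (4 * (2 * D) ^ d) with hC₁
  set C₂ : ℝ := 2 * (4 * c / r₀) ^ d with hC₂
  have hC₁pos : 0 < C₁ := by positivity
  have hC₂pos : 0 < C₂ := by positivity
  refine ⟨d + C₁ + C₂, by positivity, ?_⟩
  rintro X q hX T rfl hT j v hv hv2
  have hq := hX.pos
  obtain ⟨x, hx, y, hy, hxy⟩ := Finset.one_lt_card.1 (show 1 < v.card from hv2)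
  have hvne : v.Nonempty := ⟨x, hx⟩
  have hne : T.root.Nonempty := by
    have := two_pow_mul_card_le hT hv hv2
    refine Finset.card_pos.1 ?_
    by_contra h0
    have : 0 < 2 ^ j * v.card := by positivity
    omega
  obtain ⟨K, hK⟩ := exists_isCell_of_hasCluster hX hΩ hr hD hball hΩD (hthr q hq) T Ω hT
    (isCell_root hX.subset hne hΩ hΩc hr hball hΩD hc₀pos hc₀D) j v hv
  have hvX := hK.subset_sample
  have hdiam := diam_le_diam_boundingBox hvne
  have hqdist := hX.sep x (hvX hx) y (hvX hy) hxy
  have hqv : 2 * q ≤ diam (v : Set 𝔼) :=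
    hqdist.trans (dist_le_diam_of_mem v.finite_toSet.isBounded hx hy)
  set b := diam (boundingBox v) with hb
  have hb0 : 0 ≤ b := diam_nonneg
  have hqD : q ≤ D := by
    have h1 := mem_closedBall.1 (hΩD (hX.subset (hvX hx)))
    have h2 := mem_closedBall.1 (hΩD (hX.subset (hvX hy)))
    linarith [dist_triangle_right x y x₀]
  set τ : ℝ := (2 : ℝ) ^ (-(j : ℝ) / (d : ℝ)) with hτ
  have hτ0 : 0 ≤ τ := by positivity
  have hτd : τ ^ d = ((2 : ℝ) ^ j)⁻¹ := by
    rw [hτ, ← Real.rpow_natCast, ← Real.rpow_mul (by norm_num), div_mul_cancel₀ _ hd'.ne',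
      Real.rpow_neg (by norm_num), Real.rpow_natCast]
  have hP : (0 : ℝ) < 2 ^ j := by positivity
  have hcount₁ : (2 : ℝ) ^ j * v.card ≤ 4 * T.root.card := by
    exact_mod_cast two_pow_mul_card_le hT hv hv2
  have hcount₂ : (T.root.card : ℝ) ≤ 2 * (2 ^ j * v.card) := by
    have h1 := card_root_add_two_le T hT j v hv
    have h2 : 2 ^ j * (v.card + 2) ≤ 2 ^ j * (2 * v.card) := by gcongr; omega
    have h3 : T.root.card ≤ 2 * (2 ^ j * v.card) := by linarith
    exact_mod_cast h3
  have hroot₁ : T.root.card * q ^ d ≤ (2 * D) ^ d :=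
    card_mul_pow_le hq hX.sep (hX.subset.trans hΩD) hqD
  have hroot₂ : r₀ ^ d ≤ T.root.card * (c * q) ^ d := by
    have h := volume_le_card_mul (V := T.root) (h := c * q) (by positivity)
      (fun z hz => hX.fill z (hball hz))
    rw [volume_real_closedBall x₀ hr.le, ← mul_assoc] at h
    exact le_of_mul_le_mul_right h volume_real_ball_pos
  have hcluster : v.card * q ^ d ≤ (2 * b) ^ d :=
    card_mul_pow_le hq (fun x hx y hy => hX.sep x (hvX hx) y (hvX hy)) (z := x)
      (fun z hz => mem_closedBall.2
        ((dist_le_diam_of_mem v.finite_toSet.isBounded hz hx).trans hdiam)) (by linarith)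
  have : Nonempty (Fin d) := ⟨⟨0, hd⟩⟩
  obtain ⟨l, hl⟩ := Finite.exists_max (coordWidth K)
  have hwidth := hK.coordWidth_pow_le hX hd hΩ hr hD hball hΩD hApos.le (hthr q hq) hl
  rw [← hB] at hwidth
  have hbw : b ≤ d * coordWidth K l :=
    diam_boundingBox_le (coordWidth_nonneg hK.isCompact hK.nonempty_body l) fun k =>
      (coordWidth_mono v.finite_toSet.isCompact hvne hK.isCompact hK.subset k).trans (hl k)
  -- Width of the cell against its count, then the count against `2 ^ (-j)` of all points, then
  -- packing of all points in the ball of radius `D`.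
  have hupper : b ^ d ≤ C₁ * τ ^ d := by
    rw [hτd, ← div_eq_mul_inv, le_div_iff₀ hP]
    calc b ^ d * 2 ^ j ≤ (d * coordWidth K l) ^ d * 2 ^ j := by gcongr
      _ = d ^ d * coordWidth K l ^ d * 2 ^ j := by rw [mul_pow]
      _ ≤ d ^ d * ((A ^ d + (2 * c / B) ^ d) * (v.card * q ^ d)) * 2 ^ j := by gcongr
      _ = (A ^ d + (2 * c / B) ^ d) * d ^ d * ((2 ^ j * v.card) * q ^ d) := by ring
      _ ≤ (A ^ d + (2 * c / B) ^ d) * d ^ d * ((4 * T.root.card) * q ^ d) := by gcongr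
      _ = (A ^ d + (2 * c / B) ^ d) * d ^ d * (4 * (T.root.card * q ^ d)) := by ring
      _ ≤ _ := by rw [hC₁]; gcongr
  -- Here cells play no role: the points of `X` cover a ball of radius `r₀`, and those of `v` are
  -- packed near a set of diameter at most `b`.
  have hlower : τ ^ d ≤ C₂ * b ^ d := by
    rw [hτd, inv_le_iff_one_le_mul₀ hP]
    refine le_of_mul_le_mul_left ?_ (by positivity : 0 < r₀ ^ d)
    calc r₀ ^ d * 1 ≤ T.root.card * (c * q) ^ d := by rw [mul_one]; exact hroot₂
      _ ≤ 2 * (2 ^ j * v.card) * (c * q) ^ d := by gcongr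
      _ = 2 * 2 ^ j * c ^ d * (v.card * q ^ d) := by rw [mul_pow]; ring
      _ ≤ 2 * 2 ^ j * c ^ d * (2 * b) ^ d := by gcongr
      _ ≤ 2 * 2 ^ j * c ^ d * (4 * b) ^ d := by gcongr; norm_num
      _ = _ := by
        rw [hC₂, div_pow, mul_pow, mul_pow]
        field_simp
  refine ⟨⟨?_, ?_⟩, ?_, ?_⟩
  · nlinarith
  · have h1 := diam_boundingBox_le diam_nonneg (coordWidth_le_diam hvne)
    refine h1.trans ?_
    gcongr
    linarith
  · exact le_mul_of_pow_le hd.ne' hτ0 hupper (by linarith) (by linarith)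
  · exact le_mul_of_pow_le hd.ne' hb0 hlower (by linarith) (by linarith)

/-! ### From quasi-uniform sequences to samplings of the closure -/

/-- The members of a quasi-uniform sequence sample the closure of `Ω`. -/
lemma IsQuasiUniform.exists_isSampling {Ω : Set 𝔼} {c : ℝ≥0} {X : ℕ → Finset 𝔼}
    (hX : IsQuasiUniform Ω c X) {N : ℕ} (hN : 2 ≤ (X N).card) :
    ∃ q, IsSampling (closure Ω) (X N) (max c 1) q := by
  obtain ⟨x, hx, y, hy, hxy⟩ := Finset.one_lt_card.1 (show 1 < (X N).card from hN)
  set s : ℝ≥0∞ := Set.einfsep (X N : Set 𝔼) with hs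
  have hspos : 0 < s := (X N).finite_toSet.einfsep_pos
  have hsfin : s ≠ ⊤ :=
    ((Set.einfsep_le_edist_of_mem (s := (X N : Set 𝔼)) hx hy hxy).trans_lt (edist_lt_top x y)).ne
  have hsreal : 0 < s.toReal := ENNReal.toReal_pos hspos.ne' hsfin
  refine ⟨s.toReal / 2, by positivity, le_max_right _ _,
    (hX.subset N).trans subset_closure, fun a ha b hb hab => ?_, fun z hz => ?_⟩
  · have := ENNReal.toReal_mono (edist_ne_top a b)
      (Set.einfsep_le_edist_of_mem (s := (X N : Set 𝔼)) ha hb hab)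
    rw [← dist_edist] at this
    linarith
  · have hfill : infEDist z (X N : Set 𝔼) ≤ c * separationRadius (X N) := by
      -- The distance to a finite set is continuous, so the fill bound extends from `Ω` to its
      -- closure.
      have hclosed : IsClosed {z : 𝔼 | infEDist z (X N : Set 𝔼) ≤ c * separationRadius (X N)} :=
        isClosed_le continuous_infEDist continuous_const
      refine closure_minimal (fun w hw => ?_) hclosed hz
      exact (le_iSup₂ (f := fun w (_ : w ∈ Ω) => infEDist w (X N : Set 𝔼)) w hw).trans
        (hX.fill_le N hN)
    obtain ⟨a, ha, hza⟩ := (X N).finite_toSet.isCompact.exists_infEDist_eq_edist ⟨x, hx⟩ z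
    refine ⟨a, ha, ?_⟩
    rw [hza, separationRadius, ← hs] at hfill
    have hfin : (c : ℝ≥0∞) * (s / 2) ≠ ⊤ :=
      ENNReal.mul_ne_top ENNReal.coe_ne_top (ENNReal.div_ne_top hsfin two_ne_zero)
    have h := ENNReal.toReal_mono hfin hfill
    rw [← dist_edist, ENNReal.toReal_mul, ENNReal.toReal_div, ENNReal.coe_toReal,
      ENNReal.toReal_ofNat] at h
    refine h.trans ?_
    gcongr
    exact le_max_left _ _

end Samplet

theorem corollary4p2p7 {d : ℕ} (Ω : Set (EuclideanSpace ℝ (Fin d)))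
    (hconv : Convex ℝ Ω) (hvol : 0 < MeasureTheory.volume Ω) (c : NNReal) :
    ∃ C : ℝ, 0 < C ∧
      ∀ X : ℕ → Finset (EuclideanSpace ℝ (Fin d)), Samplet.IsQuasiUniform Ω c X →
      ∀ (N : ℕ) (T : Samplet.ClusterTree (EuclideanSpace ℝ (Fin d))),
        T.root = X N → T.IsMedianSplitTree →
      ∀ (j : ℕ) (v : Finset (EuclideanSpace ℝ (Fin d))), T.HasCluster j v → 2 ≤ v.card →
        Samplet.Comparable C
          (Metric.diam (v : Set (EuclideanSpace ℝ (Fin d))))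
          (Metric.diam (Samplet.boundingBox v)) ∧
        Samplet.Comparable C
          (Metric.diam (Samplet.boundingBox v))
          ((2 : ℝ) ^ (-(j : ℝ) / (d : ℝ))) := by
  -- Quasi-uniformity constrains only samples with at least two points; a cluster with two points
  -- forces this for the root.
  have hroot : ∀ (T : Samplet.ClusterTree (EuclideanSpace ℝ (Fin d))), T.IsMedianSplitTree →
      ∀ (j : ℕ) (v : Finset (EuclideanSpace ℝ (Fin d))), T.HasCluster j v → 2 ≤ v.card →
        2 ≤ T.root.card := by
    intro T hT j v hv hv2
    have h := Samplet.two_pow_mul_sizeWeight_le T hT j v hv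
    have h1 : 0 < Samplet.sizeWeight v.card := by
      unfold Samplet.sizeWeight; split_ifs <;> omega
    have h2 : 0 < 2 ^ j * Samplet.sizeWeight v.card := by positivity
    by_contra hlt
    have h3 : Samplet.sizeWeight T.root.card = 0 := by
      unfold Samplet.sizeWeight; split_ifs <;> omega
    omega
  rcases Nat.eq_zero_or_pos d with rfl | hd
  · refine ⟨1, one_pos, fun X _ N T _ _ j v _ hv2 => ?_⟩
    exact absurd (Finset.card_le_one_of_subsingleton v) (by omega)
  by_cases hbdd : Bornology.IsBounded Ω
  · have hint : (interior Ω).Nonempty := by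
      by_contra hempty
      rw [Set.not_nonempty_iff_eq_empty] at hempty
      have hsub : Ω ⊆ frontier Ω := by
        rw [frontier, hempty, Set.sdiff_empty]
        exact subset_closure
      have h0 := MeasureTheory.measure_mono_null hsub
        (hconv.addHaar_frontier MeasureTheory.volume)
      exact hvol.ne' h0
    obtain ⟨x₀, hx₀⟩ := hint
    obtain ⟨r₀, hr, hball⟩ := Metric.nhds_basis_closedBall.mem_iff.1 (mem_interior_iff_mem_nhds.1 hx₀)
    obtain ⟨D, hD, hΩD⟩ := hbdd.closure.subset_closedBall_lt 0 x₀
    obtain ⟨C, hC, h⟩ := Samplet.exists_comparable hd hconv.closure hbdd.isCompact_closure hr hD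
      (hball.trans subset_closure) hΩD (le_max_right (c : ℝ) 1)
    refine ⟨C, hC, fun X hX N T hTX hT j v hv hv2 => ?_⟩
    obtain ⟨q, hq⟩ := hX.exists_isSampling (N := N) (hTX ▸ hroot T hT j v hv hv2)
    exact h (X N) q hq T hTX hT j v hv hv2
  · refine ⟨1, one_pos, fun X hX N T hTX hT j v hv hv2 => absurd ?_ hbdd⟩
    obtain ⟨q, hq⟩ := hX.exists_isSampling (N := N) (hTX ▸ hroot T hT j v hv hv2)
    refine (X N).finite_toSet.isBounded.cthickening (δ := max c 1 * q) |>.subset fun z hz => ?_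
    obtain ⟨x, hx, hzx⟩ := hq.fill z (subset_closure hz)
    exact Metric.mem_cthickening_of_dist_le z x _ _ hx hzx
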